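/- \textbf{Setting.} There are an agent and a finite set $\mathcal J$ of principals. The type space $\Theta$ and, for each $j\in\mathcal J$, the sets $X_j$ (contractible actions) and $Y_j$ (non-contractible actions) are standard Borel spaces, $X=\prod_jX_j$, $Y=\prod_jY_j$, and $F_j:X_j\rightrightarrows Y_j$ is a non-empty-valued correspondence such that $\{(x_j,y_j):y_j\in F_j(x_j)\}$ has at least two elements and $F_j(x_j)$ is Borel for at least one $x_j$ (so that every principal has an admissible contract). A payoff environment $\mathcal E=\langle\mu,U,u,(v_j)_{j\in\mathcal J}\rangle$ consists of a prior $\mu\in\Delta(\Theta)$ and measurable functions $U:\Theta\to\mathbb R$ and $u,v_j:X\times Y\times\Theta\to\mathbb R$, where $v_j(x,y,\cdot)$ is bounded for all $(x,y)$ (i.e. it has a finite expectation under every belief). \textbf{Contracts.} For $L\subseteq X_j$ let $M_j(L)=\{(x,y):x\in L,\ y\in F_j(x)\}$. An admissible contract of $j$ is a measurable map $G_j:M_j\to X_j$ on a non-empty standard Borel space $M_j$ such that $L=G_j(M_j)$ and $M_j(L)$ are Borel, $F_j$ has a measurable selector on $L$, and $G_j$ has a measurable selector (right inverse) on its image $L$.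 A contract space is a product $\mathcal G=\prod_j\mathcal G_j$ of non-empty sets $\mathcal G_j$ of admissible contracts of $j$. The space of menus with recommendations $\mathcal G^*=\prod_j\mathcal G_j^*$ has as elements of $\mathcal G^*_j$ the maps $M_j(L)\to X_j$, $(x,y)\mapsto x$, one for each non-empty Borel set $L\subseteq X_j$ such that $M_j(L)$ is Borel and there is a measurable $s:L\to M_j(L)$ with $s(x)\in\{x\}\times F_j(x)$ for all $x \in L$. \textbf{Equilibrium (public contracting).} For a contract profile $G=(G_j:M_j\to X_j)_j$ let $M=\prod_jM_j$ and $G(m)=(G_j(m_j))_j$. A play of $G$ consists of $q:\Theta\to\Delta(M)$, of $\gamma=(\gamma_j)_j$ with $\gamma_j:M\to Y_j$ and $\gamma_j(m)\in F_j(G_j(m_j))$ for all $m$, and of beliefs $p_j:M\to\Delta(\Theta)$. These are measurable with respect to the completed measures: with $\nu(E)=\int q(\theta)[E]\,\mu(d\theta)$, the map $q$ is $\mu$-measurable, $\gamma$ is $q(\theta)$-measurable for every $\theta$ and $\nu$-measurable, and each $p_j$ is $\nu$-measurable. The profile $[G,(\gamma,q,p)]$ is a $\mathcal G$-continuation equilibrium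 if $G\in\mathcal G$ and the following hold. \begin{itemize} \item For all $j$ and all measurable $E_1\subseteq\Theta$, $E_2\subseteq M$: $\int_{E_1}q(\theta)[E_2]\,\mu(d\theta)=\int_\Theta\int_{E_2}p_j(m)[E_1]\,q(\theta)[dm]\,\mu(d\theta)$. \item For every $\theta\in\Theta$, $m\mapsto u(G(m),\gamma(m),\theta)$ is $q(\theta)$-integrable and $\int_Mu(G(m),\gamma(m),\theta)\,q(\theta)[dm]\ge\max\{U(\theta),\sup_{m\in M}u(G(m),\gamma(m),\theta)\}$. \item For all $j$, $m\in M$ and $y_j\in F_j(G_j(m_j))$: $\int_\Theta v_j(G(m),\gamma(m),\theta)\,p_j(m)[d\theta]\ge\int_\Theta v_j(G(m),(y_j,\gamma_{-j}(m)),\theta)\,p_j(m)[d\theta]$. \item For every $j$ the ex ante payoff $V_j[G,(\gamma,q,p)]=\int_\Theta\int_Mv_j(G(m),\gamma(m),\theta)\,q(\theta)[dm]\,\mu(d\theta)$ converges absolutely. \end{itemize} Its allocation is $z:\Theta\to\Delta(X\times Y)$, $z(\theta)[E]=q(\theta)[\{m:(G(m),\gamma(m))\in E\}]$. A $\mathcal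 G$-continuation equilibrium $[G,(\gamma,q,p)]$ is a $\mathcal G$-robust equilibrium if for every $j$ and every $G_j'\in\mathcal G_j$ there is a $\mathcal G$-continuation equilibrium $[(G'_j,G_{-j}),(\gamma',q',p')]$ with $V_j[G,(\gamma,q,p)]\ge V_j[(G'_j,G_{-j}),(\gamma',q',p')]$. It is an unrestricted robust equilibrium if it is a $\mathcal G$-robust equilibrium for every contract space $\mathcal G$ with $G\in\mathcal G$. A contract space $\mathcal G$ is canonical for robust equilibrium if, for every payoff environment $\mathcal E$, the set of allocations of $\mathcal G$-robust equilibria equals the set of allocations of unrestricted robust equilibria. \textbf{Theorem.} Suppose $|\mathcal J|\ge2$ and $|\Theta|\ge|X|$. Then $\mathcal G^*$ is a contract space that is canonical for robust equilibrium, and $|\mathcal G^*|\le|\mathcal G'|$ for every contract space $\mathcal G'$ that is canonical for robust equilibrium. -/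

import Mathlib

open MeasureTheory
open scoped ENNReal

universe u

namespace Contracting

/-! ### Contracts of a single principal -/

/-- The set `{(x, y) : x ∈ L, y ∈ F x}` of feasible pairs over a set `L` of contractible actions. -/
def feasiblePairs {X Y : Type u} (F : X → Set Y) (L : Set X) : Set (X × Y) :=
  {a | a.1 ∈ L ∧ a.2 ∈ F a.1}

/-- An admissible contract `G : M → X` of a principal with contractible actions `X`,
non-contractible actions `Y` and feasibility correspondence `F`. The message space is a non-empty
standard Borel space, `G` is measurable with Borel image `L`, the feasible pairs over `L` form a
Borel set, `F` has a measurable selector on `L`, and `G` has a measurable selector on its image. -/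
structure Contract {X Y : Type u} [MeasurableSpace X] [MeasurableSpace Y] (F : X → Set Y) where
  Msg : Type u
  msgMeasurableSpace : MeasurableSpace Msg
  msgStandardBorel : StandardBorelSpace Msg
  msgNonempty : Nonempty Msg
  toFun : Msg → X
  measurable_toFun : Measurable toFun
  measurableSet_range : MeasurableSet (Set.range toFun)
  measurableSet_feasiblePairs : MeasurableSet (feasiblePairs F (Set.range toFun))
  exists_feasible_selector :
    ∃ s : Set.range toFun → Y, Measurable s ∧ ∀ x : Set.range toFun, s x ∈ F (x : X)
  exists_message_selector :
    ∃ r : Set.range toFun → Msg, Measurable r ∧ ∀ x : Set.range toFun, toFun (r x) = (x : X)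

attribute [instance] Contract.msgMeasurableSpace Contract.msgStandardBorel Contract.msgNonempty

/-- The admissible measurable menus of contractible actions: non-empty Borel sets `L` whose set of
feasible pairs is Borel and admits a measurable selector `L → feasiblePairs F L`. -/
def menus {X Y : Type u} [MeasurableSpace X] [MeasurableSpace Y] (F : X → Set Y) : Set (Set X) :=
  {L | L.Nonempty ∧ MeasurableSet L ∧ MeasurableSet (feasiblePairs F L) ∧
    ∃ s : L → feasiblePairs F L, Measurable s ∧ ∀ x : L, (s x : X × Y).1 = (x : X)}

theorem range_fst_feasiblePairs {X Y : Type u} [MeasurableSpace X] [MeasurableSpace Y]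
    {F : X → Set Y} {L : Set X} (hL : L ∈ menus F) :
    Set.range (fun m : feasiblePairs F L => (m : X × Y).1) = L := by
  obtain ⟨-, -, -, s, -, hs⟩ := hL
  ext x
  constructor
  · rintro ⟨m, rfl⟩
    exact m.2.1
  · intro hx
    exact ⟨s ⟨x, hx⟩, hs ⟨x, hx⟩⟩

/-- The menu with recommendations attached to a menu `L`: the agent sends a feasible pair `(x, y)`
with `x ∈ L`, and the contract commits to `x` only. -/
def menuContract {X Y : Type u} [MeasurableSpace X] [MeasurableSpace Y]
    [StandardBorelSpace X] [StandardBorelSpace Y] (F : X → Set Y) (L : Set X) (hL : L ∈ menus F) :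
    Contract F where
  Msg := feasiblePairs F L
  msgMeasurableSpace := inferInstance
  msgStandardBorel := hL.2.2.1.standardBorel
  msgNonempty := by
    obtain ⟨⟨x, hx⟩, -, -, s, -, -⟩ := hL
    exact ⟨s ⟨x, hx⟩⟩
  toFun := fun m => (m : X × Y).1
  measurable_toFun := measurable_fst.comp measurable_subtype_coe
  measurableSet_range := by
    rw [range_fst_feasiblePairs hL]
    exact hL.2.1
  measurableSet_feasiblePairs := by
    rw [range_fst_feasiblePairs hL]
    exact hL.2.2.1
  exists_feasible_selector := by
    rw [range_fst_feasiblePairs hL]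
    obtain ⟨-, -, -, s, hs, hs'⟩ := hL
    refine ⟨fun x => (s x : X × Y).2, measurable_snd.comp (measurable_subtype_coe.comp hs), ?_⟩
    intro x
    have h := (s x).2.2
    rwa [hs' x] at h
  exists_message_selector := by
    rw [range_fst_feasiblePairs hL]
    obtain ⟨-, -, -, s, hs, hs'⟩ := hL
    exact ⟨s, hs, hs'⟩

/-- A profile `(𝒢 j)` of sets of contracts; it stands for the product `×ⱼ 𝒢 j`. -/
abbrev SpaceProfile {J : Type u} {X Y : J → Type u} [∀ j, MeasurableSpace (X j)]
    [∀ j, MeasurableSpace (Y j)] (F : ∀ j, X j → Set (Y j)) : Type (u + 1) :=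
  ∀ j, Set (Contract (F j))

/-- A contract space gives every principal a non-empty set of admissible contracts. -/
def IsContractSpace {J : Type u} {X Y : J → Type u} [∀ j, MeasurableSpace (X j)]
    [∀ j, MeasurableSpace (Y j)] {F : ∀ j, X j → Set (Y j)} (𝒢 : SpaceProfile F) : Prop :=
  ∀ j, (𝒢 j).Nonempty

/-- The cardinality of the product `×ⱼ 𝒢 j`. -/
noncomputable def spaceCard {J : Type u} {X Y : J → Type u} [∀ j, MeasurableSpace (X j)]
    [∀ j, MeasurableSpace (Y j)] {F : ∀ j, X j → Set (Y j)} (𝒢 : SpaceProfile F) :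
    Cardinal.{u + 1} :=
  Cardinal.mk (∀ j, 𝒢 j)

/-- The space `𝒢*` of menus with recommendations. -/
def menuSpace {J : Type u} {X Y : J → Type u} [∀ j, MeasurableSpace (X j)]
    [∀ j, MeasurableSpace (Y j)] [∀ j, StandardBorelSpace (X j)] [∀ j, StandardBorelSpace (Y j)]
    (F : ∀ j, X j → Set (Y j)) : SpaceProfile F :=
  fun j => {C | ∃ (L : Set (X j)) (hL : L ∈ menus (F j)), C = menuContract (F j) L hL}

/-! ### Payoff environments -/

/-- A payoff environment `⟨μ, U, u, (vⱼ)⟩`: prior, outside option, utility of the agent, utilities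
of the principals. For every action profile the utility of a principal is bounded in the state;
equivalently, it has a finite expectation under every belief on the states. -/
structure Environment (Θ : Type u) [MeasurableSpace Θ] {J : Type u} (X Y : J → Type u)
    [∀ j, MeasurableSpace (X j)] [∀ j, MeasurableSpace (Y j)] where
  prior : Measure Θ
  isProbabilityMeasure_prior : IsProbabilityMeasure prior
  outside : Θ → ℝ
  measurable_outside : Measurable outside
  agent : (∀ j, X j) → (∀ j, Y j) → Θ → ℝ
  measurable_agent :
    Measurable fun a : (∀ j, X j) × (∀ j, Y j) × Θ => agent a.1 a.2.1 a.2.2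
  principal : J → (∀ j, X j) → (∀ j, Y j) → Θ → ℝ
  measurable_principal : ∀ j,
    Measurable fun a : (∀ j, X j) × (∀ j, Y j) × Θ => principal j a.1 a.2.1 a.2.2
  principal_bounded : ∀ j x y, ∃ B : ℝ, ∀ θ, |principal j x y θ| ≤ B

attribute [instance] Environment.isProbabilityMeasure_prior

/-! ### Continuation play after a profile of contracts -/

/-- Message profiles `M = ×ₖ Mₖ`. -/
abbrev MsgProfile {J : Type u} {X Y : J → Type u} [∀ j, MeasurableSpace (X j)]
    [∀ j, MeasurableSpace (Y j)] {F : ∀ j, X j → Set (Y j)} (G : ∀ j, Contract (F j)) : Type u :=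
  ∀ k, (G k).Msg

/-- The profile of contractible actions selected by a message profile. -/
def chosen {J : Type u} {X Y : J → Type u} [∀ j, MeasurableSpace (X j)]
    [∀ j, MeasurableSpace (Y j)] {F : ∀ j, X j → Set (Y j)} (G : ∀ j, Contract (F j))
    (m : MsgProfile G) : ∀ j, X j :=
  fun k => (G k).toFun (m k)

/-- A triple `(γ, q, p)` for a fixed contract profile: the non-contractible actions `γ`, the
messaging strategy `q : Θ → Δ(M)` and the beliefs `pⱼ : M → Δ(Θ)`. -/
structure Play (Θ : Type u) [MeasurableSpace Θ] {J : Type u} {X Y : J → Type u}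
    [∀ j, MeasurableSpace (X j)] [∀ j, MeasurableSpace (Y j)] {F : ∀ j, X j → Set (Y j)}
    (G : ∀ j, Contract (F j)) where
  act : MsgProfile G → ∀ j, Y j
  act_mem : ∀ m j, act m j ∈ F j (chosen G m j)
  msg : Θ → Measure (MsgProfile G)
  isProbabilityMeasure_msg : ∀ θ, IsProbabilityMeasure (msg θ)
  belief : J → MsgProfile G → Measure Θ
  isProbabilityMeasure_belief : ∀ j m, IsProbabilityMeasure (belief j m)

attribute [instance] Play.isProbabilityMeasure_msg Play.isProbabilityMeasure_belief

/-- Measurability of strategies and beliefs, for the completed measures: `q` for the prior `μ`;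
`γ` for every `q θ` and for the law `μ.bind q` of the message profile; `p` for that law. -/
structure Play.IsMeasurable {Θ : Type u} [MeasurableSpace Θ] {J : Type u} {X Y : J → Type u}
    [∀ j, MeasurableSpace (X j)] [∀ j, MeasurableSpace (Y j)] {F : ∀ j, X j → Set (Y j)}
    {G : ∀ j, Contract (F j)} (c : Play Θ G) (μ : Measure Θ) : Prop where
  msg : AEMeasurable c.msg μ
  act : ∀ θ, AEMeasurable c.act (c.msg θ)
  act_bind : AEMeasurable c.act (μ.bind c.msg)
  belief : ∀ j, AEMeasurable (c.belief j) (μ.bind c.msg)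

/-- Bayesian consistency of the beliefs with the messaging strategy. -/
def Play.IsBayesian {Θ : Type u} [MeasurableSpace Θ] {J : Type u} {X Y : J → Type u}
    [∀ j, MeasurableSpace (X j)] [∀ j, MeasurableSpace (Y j)] {F : ∀ j, X j → Set (Y j)}
    {G : ∀ j, Contract (F j)} (c : Play Θ G) (μ : Measure Θ) : Prop :=
  ∀ (j : J) (E₁ : Set Θ) (E₂ : Set (MsgProfile G)), MeasurableSet E₁ → MeasurableSet E₂ →
    ∫⁻ θ in E₁, c.msg θ E₂ ∂μ = ∫⁻ θ, ∫⁻ m in E₂, c.belief j m E₁ ∂(c.msg θ) ∂μ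

/-- The allocation `z : Θ → Δ(X × Y)` induced by a profile. -/
noncomputable def Play.allocation {Θ : Type u} [MeasurableSpace Θ] {J : Type u} {X Y : J → Type u}
    [∀ j, MeasurableSpace (X j)] [∀ j, MeasurableSpace (Y j)] {F : ∀ j, X j → Set (Y j)}
    {G : ∀ j, Contract (F j)} (c : Play Θ G) : Θ → Measure ((∀ j, X j) × (∀ j, Y j)) :=
  fun θ => (c.msg θ).map fun m => (chosen G m, c.act m)

/-- The ex ante payoff `Vⱼ` of principal `j`. -/
noncomputable def Play.value {Θ : Type u} [MeasurableSpace Θ] {J : Type u} {X Y : J → Type u}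
    [∀ j, MeasurableSpace (X j)] [∀ j, MeasurableSpace (Y j)] {F : ∀ j, X j → Set (Y j)}
    {G : ∀ j, Contract (F j)} (c : Play Θ G) (E : Environment Θ X Y) (j : J) : ℝ :=
  ∫ θ, ∫ m, E.principal j (chosen G m) (c.act m) θ ∂(c.msg θ) ∂E.prior

/-! ### Equilibrium -/

/-- The profile `[G, (γ, q, p)]` is a `𝒢`-continuation equilibrium. Agent optimality says that the
expected utility of every type `θ` is at least `max {U θ, sup_m u}`. The two integrability
conditions say that the expected utilities of the agent and the ex ante payoffs of the principals
are finite. -/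
structure IsContinuationEquilibrium {Θ : Type u} [MeasurableSpace Θ] {J : Type u} [DecidableEq J]
    {X Y : J → Type u} [∀ j, MeasurableSpace (X j)] [∀ j, MeasurableSpace (Y j)]
    {F : ∀ j, X j → Set (Y j)} (E : Environment Θ X Y) (𝒢 : SpaceProfile F)
    (G : ∀ j, Contract (F j)) (c : Play Θ G) : Prop where
  mem : ∀ j, G j ∈ 𝒢 j
  measurable : c.IsMeasurable E.prior
  bayesian : c.IsBayesian E.prior
  agent_integrable : ∀ θ, Integrable (fun m => E.agent (chosen G m) (c.act m) θ) (c.msg θ)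
  agent_participation : ∀ θ, E.outside θ ≤ ∫ m, E.agent (chosen G m) (c.act m) θ ∂(c.msg θ)
  agent_optimal : ∀ θ m, E.agent (chosen G m) (c.act m) θ ≤
    ∫ m', E.agent (chosen G m') (c.act m') θ ∂(c.msg θ)
  principal_integrable : ∀ j,
    ∫⁻ θ, ∫⁻ m, ‖E.principal j (chosen G m) (c.act m) θ‖ₑ ∂(c.msg θ) ∂E.prior ≠ ∞
  principal_optimal : ∀ (j : J) (m : MsgProfile G), ∀ y ∈ F j (chosen G m j),
    ∫ θ, E.principal j (chosen G m) (Function.update (c.act m) j y) θ ∂(c.belief j m) ≤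
      ∫ θ, E.principal j (chosen G m) (c.act m) θ ∂(c.belief j m)

/-- `𝒢`-robust (no-safe-deviation) equilibrium. -/
def IsRobustEquilibrium {Θ : Type u} [MeasurableSpace Θ] {J : Type u} [DecidableEq J]
    {X Y : J → Type u} [∀ j, MeasurableSpace (X j)] [∀ j, MeasurableSpace (Y j)]
    {F : ∀ j, X j → Set (Y j)} (E : Environment Θ X Y) (𝒢 : SpaceProfile F)
    (G : ∀ j, Contract (F j)) (c : Play Θ G) : Prop :=
  IsContinuationEquilibrium E 𝒢 G c ∧
    ∀ (j : J), ∀ G' ∈ 𝒢 j, ∃ c' : Play Θ (Function.update G j G'),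
      IsContinuationEquilibrium E 𝒢 (Function.update G j G') c' ∧ c'.value E j ≤ c.value E j

/-- Unrestricted robust equilibrium: `𝒢`-robust for every contract space `𝒢` that contains `G`. -/
def IsUnrestrictedRobustEquilibrium {Θ : Type u} [MeasurableSpace Θ] {J : Type u} [DecidableEq J]
    {X Y : J → Type u} [∀ j, MeasurableSpace (X j)] [∀ j, MeasurableSpace (Y j)]
    {F : ∀ j, X j → Set (Y j)} (E : Environment Θ X Y)
    (G : ∀ j, Contract (F j)) (c : Play Θ G) : Prop :=
  ∀ 𝒢 : SpaceProfile F, IsContractSpace 𝒢 → (∀ j, G j ∈ 𝒢 j) → IsRobustEquilibrium E 𝒢 G c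

/-- Allocations induced by `𝒢`-robust equilibria. -/
def robustAllocations {Θ : Type u} [MeasurableSpace Θ] {J : Type u} [DecidableEq J]
    {X Y : J → Type u} [∀ j, MeasurableSpace (X j)] [∀ j, MeasurableSpace (Y j)]
    {F : ∀ j, X j → Set (Y j)} (E : Environment Θ X Y) (𝒢 : SpaceProfile F) :
    Set (Θ → Measure ((∀ j, X j) × (∀ j, Y j))) :=
  {z | ∃ (G : ∀ j, Contract (F j)) (c : Play Θ G),
    IsRobustEquilibrium E 𝒢 G c ∧ c.allocation = z}

/-- Allocations induced by unrestricted robust equilibria. -/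
def unrestrictedRobustAllocations {Θ : Type u} [MeasurableSpace Θ] {J : Type u} [DecidableEq J]
    {X Y : J → Type u} [∀ j, MeasurableSpace (X j)] [∀ j, MeasurableSpace (Y j)]
    (F : ∀ j, X j → Set (Y j)) (E : Environment Θ X Y) :
    Set (Θ → Measure ((∀ j, X j) × (∀ j, Y j))) :=
  {z | ∃ (G : ∀ j, Contract (F j)) (c : Play Θ G),
    IsUnrestrictedRobustEquilibrium E G c ∧ c.allocation = z}

/-! ### Canonical and minimal contract spaces -/

/-- A contract space is canonical for robust equilibrium if, in every payoff environment, its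
robust equilibrium allocations are exactly the unrestricted ones. -/
def IsCanonicalForRobust (Θ : Type u) [MeasurableSpace Θ] {J : Type u} [DecidableEq J]
    {X Y : J → Type u} [∀ j, MeasurableSpace (X j)] [∀ j, MeasurableSpace (Y j)]
    {F : ∀ j, X j → Set (Y j)} (𝒢 : SpaceProfile F) : Prop :=
  IsContractSpace 𝒢 ∧
    ∀ E : Environment Θ X Y, robustAllocations E 𝒢 = unrestrictedRobustAllocations F E

/-- A canonical contract space of least cardinality. -/
def IsMinimalCanonicalForRobust (Θ : Type u) [MeasurableSpace Θ] {J : Type u} [DecidableEq J]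
    {X Y : J → Type u} [∀ j, MeasurableSpace (X j)] [∀ j, MeasurableSpace (Y j)]
    {F : ∀ j, X j → Set (Y j)} (𝒢 : SpaceProfile F) : Prop :=
  IsCanonicalForRobust Θ 𝒢 ∧
    ∀ 𝒢' : SpaceProfile F, IsCanonicalForRobust Θ 𝒢' → spaceCard 𝒢 ≤ spaceCard 𝒢'

end Contracting

/-!
Menus with recommendations form a canonical contract space of least cardinality.

*Unrestricted equilibria are equilibria in menus.* Given a continuation equilibrium of an arbitrary
contract profile, let the agent report, instead of a message profile `m`, the outcome `(x, y)` that
`m` leads to, and let the principals follow the recommendation `y`. Given a report `(x, y)`, the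
new belief of a principal is the average of the old beliefs at the messages that lead to `(x, y)`.
Each of these beliefs makes `y` optimal, hence so does their average; the average exists for almost
all reports as a regular conditional distribution. After the remaining reports the principals act
and believe as after a single message profile with the same contractible actions, and with the
outcome `(x, y)` if there is one. That almost every report is an outcome, under the strategy of each
single type, is the fact that a conditional distribution is concentrated on the fibres
(`ae_condDistrib_fiber`). The allocation is unchanged
(`IsContinuationEquilibrium.exists_menuProfile`). Applied on path and after every deviation to a
menu, this transfers robustness.

*Equilibria in menus are unrestricted equilibria of enlarged menus.* A deviator may offer a
contract with too few messages to carry recommendations. Therefore every menu is enlarged by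
payoff-irrelevant talk. After a deviation, recommendations for the deviator are sent through the
talk with one of the other principals, so the continuation equilibrium of the menu with the same
range can be replayed (`exists_decode_of_talk`, `IsContinuationEquilibrium.exists_of_decode`). This
is where a second principal is needed.

*Minimality.* Embed `X j` measurably into the type space by `e`, make the principals indifferent,
and let type `e x` care only about whether principal `j` chooses `x`. The allocation of any
continuation equilibrium then reveals the range of the contract of `j`, and every contract profile
supports a robust equilibrium. Hence a canonical contract space contains, for every `j` and every
menu `L` of `j`, a contract with range `L` (`IsCanonicalForRobust.exists_range_eq`).
-/

namespace Contracting

open ProbabilityTheory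

/-! ### Contracts derived from a contract -/

section SinglePrincipal

variable {X Y : Type u} [MeasurableSpace X] [MeasurableSpace Y] {F : X → Set Y}

theorem Contract.range_mem_menus (C : Contract F) : Set.range C.toFun ∈ menus F := by
  obtain ⟨s, hs, hsF⟩ := C.exists_feasible_selector
  exact ⟨Set.range_nonempty _, C.measurableSet_range, C.measurableSet_feasiblePairs,
    fun x => ⟨(x, s x), x.2, hsF x⟩, (measurable_subtype_coe.prodMk hs).subtype_mk, fun _ => rfl⟩

/-- Singletons with a measurable set of feasible non-contractible actions are menus. -/
theorem singleton_mem_menus [MeasurableSingletonClass X] {x : X}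
    (hx : MeasurableSet (F x))
    (hne : (F x).Nonempty) : {x} ∈ menus F := by
  obtain ⟨y, hy⟩ := hne
  refine ⟨Set.singleton_nonempty x, measurableSet_singleton x, ?_,
    fun _ => ⟨(x, y), rfl, hy⟩, measurable_const, fun x' => x'.2.symm⟩
  have h : feasiblePairs F {x} = {x} ×ˢ F x := by
    ext ⟨a, b⟩
    constructor
    · rintro ⟨rfl, h⟩
      exact ⟨rfl, h⟩
    · rintro ⟨rfl, h⟩
      exact ⟨rfl, h⟩
  rw [h]
  exact (measurableSet_singleton x).prod hx

/-- The contract `C` with an additional payoff-irrelevant message in `R`. -/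
def Contract.withTalk (C : Contract F) (R : Type u) [MeasurableSpace R] [StandardBorelSpace R]
    [Nonempty R] : Contract F where
  Msg := C.Msg × R
  msgMeasurableSpace := inferInstance
  msgStandardBorel := inferInstance
  msgNonempty := inferInstance
  toFun := C.toFun ∘ Prod.fst
  measurable_toFun := C.measurable_toFun.comp measurable_fst
  measurableSet_range := by
    rw [Prod.fst_surjective.range_comp]
    exact C.measurableSet_range
  measurableSet_feasiblePairs := by
    rw [Prod.fst_surjective.range_comp]
    exact C.measurableSet_feasiblePairs
  exists_feasible_selector := by
    rw [Prod.fst_surjective.range_comp]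
    exact C.exists_feasible_selector
  exists_message_selector := by
    rw [Prod.fst_surjective.range_comp]
    obtain ⟨r, hr, hr'⟩ := C.exists_message_selector
    exact ⟨fun x => (r x, Classical.arbitrary R), hr.prodMk measurable_const, hr'⟩

variable [StandardBorelSpace X] [StandardBorelSpace Y]

/-- The menu with recommendations that offers the same contractible actions as `C`. -/
def Contract.toMenu (C : Contract F) : Contract F :=
  menuContract F (Set.range C.toFun) C.range_mem_menus

theorem menuContract_congr {L L' : Set X} (h : L = L') (hL : L ∈ menus F) (hL' : L' ∈ menus F) :
    menuContract F L hL = menuContract F L' hL' := by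
  subst h
  rfl

theorem toMenu_menuContract {L : Set X} (hL : L ∈ menus F) :
    (menuContract F L hL).toMenu = menuContract F L hL :=
  menuContract_congr (range_fst_feasiblePairs hL) _ _

/-- If a recommendation `y` is made by a side channel, messages to `C` together with `y` encode the
messages to the menu with recommendations: infeasible recommendations are replaced by a
measurable feasible selector. -/
theorem Contract.exists_decode_toMenu (C : Contract F) :
    ∃ (dec : Y × C.Msg → C.toMenu.Msg) (enc : C.toMenu.Msg → C.Msg) (rcm : C.toMenu.Msg → Y),
      Measurable dec ∧ Measurable enc ∧ Measurable rcm ∧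
      (∀ a, C.toMenu.toFun (dec a) = C.toFun a.2) ∧ ∀ m, dec (rcm m, enc m) = m := by
  classical
  obtain ⟨s, hs, hsF⟩ := C.exists_feasible_selector
  obtain ⟨r, hr, hr'⟩ := C.exists_message_selector
  let P := feasiblePairs F (Set.range C.toFun)
  let f : Y × C.Msg → X × Y := fun a => (C.toFun a.2, a.1)
  let g : Y × C.Msg → X × Y := fun a => (C.toFun a.2, s ⟨C.toFun a.2, a.2, rfl⟩)
  have hf : Measurable f := (C.measurable_toFun.comp measurable_snd).prodMk measurable_fst
  have hg : Measurable g := (C.measurable_toFun.comp measurable_snd).prodMk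
    (hs.comp (C.measurable_toFun.comp measurable_snd).subtype_mk)
  have hP : MeasurableSet (f ⁻¹' P) := hf C.measurableSet_feasiblePairs
  let d : Y × C.Msg → P := fun a => ⟨if a ∈ f ⁻¹' P then f a else g a, by
    split_ifs with h
    · exact h
    · exact ⟨⟨a.2, rfl⟩, hsF ⟨C.toFun a.2, a.2, rfl⟩⟩⟩
  have hd : Measurable d := (Measurable.ite hP hf hg).subtype_mk
  let e : P → C.Msg := fun m => r ⟨(m : X × Y).1, m.2.1⟩
  have he : Measurable e := hr.comp (measurable_fst.comp measurable_subtype_coe).subtype_mk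
  let t : P → Y := fun m => (m : X × Y).2
  have ht : Measurable t := measurable_snd.comp measurable_subtype_coe
  refine ⟨d, e, t, hd, he, ht, ?_, ?_⟩
  · intro a
    change (if a ∈ f ⁻¹' P then f a else g a).1 = _
    split_ifs <;> rfl
  · intro (m : P)
    have h : f (t m, e m) = (m : X × Y) := Prod.ext (hr' _) rfl
    refine Subtype.ext ?_
    change (if f (t m, e m) ∈ P then f (t m, e m) else _) = (m : X × Y)
    rw [h, if_pos m.2]

end SinglePrincipal

/-! ### Measure theory -/

section MeasureTheory

variable {Θ M N : Type*} [MeasurableSpace Θ] [MeasurableSpace M] [MeasurableSpace N]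

theorem aemeasurable_map_bind {μ : Measure Θ} {q : Θ → Measure M} (hq : AEMeasurable q μ)
    {f : M → N} (hf : AEMeasurable f (μ.bind q)) : AEMeasurable (fun θ => (q θ).map f) μ := by
  refine ⟨fun θ => (hq.mk q θ).map (hf.mk f),
    (Measure.measurable_map _ hf.measurable_mk).comp hq.measurable_mk, ?_⟩
  filter_upwards [hq.ae_eq_mk, Measure.ae_ae_of_ae_bind hq hf.ae_eq_mk] with θ h₁ h₂
  rw [← h₁]
  exact Measure.map_congr h₂

theorem bind_map_eq {μ : Measure Θ} {q : Θ → Measure M} (hq : AEMeasurable q μ)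
    {f : M → N} (hf : AEMeasurable f (μ.bind q)) :
    μ.bind (fun θ => (q θ).map f) = (μ.bind q).map f := by
  ext s hs
  rw [Measure.bind_apply hs (aemeasurable_map_bind hq hf), Measure.map_congr hf.ae_eq_mk,
    Measure.map_apply hf.measurable_mk hs,
    Measure.bind_apply (hf.measurable_mk hs) hq]
  refine lintegral_congr_ae ?_
  filter_upwards [Measure.ae_ae_of_ae_bind hq hf.ae_eq_mk] with θ h
  rw [Measure.map_congr h, Measure.map_apply hf.measurable_mk hs]

theorem isProbabilityMeasure_bind {μ : Measure Θ} [IsProbabilityMeasure μ] {q : Θ → Measure M}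
    [∀ θ, IsProbabilityMeasure (q θ)] (hq : AEMeasurable q μ) :
    IsProbabilityMeasure (μ.bind q) :=
  ⟨by rw [Measure.bind_apply MeasurableSet.univ hq]; simp⟩

/-- A regular conditional distribution of the identity given `f` is concentrated on the fibres
of `f`, also when `f` is only almost everywhere measurable. -/
theorem ae_condDistrib_fiber [StandardBorelSpace M] [Nonempty M] [StandardBorelSpace N]
    {ν : Measure M} [IsFiniteMeasure ν] {f : M → N} (hf : AEMeasurable f ν) {p : M → Prop}
    (hp : ∀ᵐ m ∂ν, p m) :
    ∀ᵐ n ∂ν.map f, ∀ᵐ m ∂condDistrib id f ν n, f m = n ∧ p m := by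
  have hA : ∀ᵐ m ∂ν, f m = hf.mk f m ∧ p m := hf.ae_eq_mk.and hp
  obtain ⟨A, hAsub, hAmeas, hAfull⟩ := exists_measurable_superset_of_null (ae_iff.1 hA)
  have hfull : ∀ᵐ x ∂(ν.map f ⊗ₘ condDistrib id f ν), x.2 ∉ A ∧ hf.mk f x.2 = x.1 := by
    have hmeas : MeasurableSet {x : N × M | x.2 ∉ A ∧ hf.mk f x.2 = x.1} :=
      (measurable_snd hAmeas.compl).inter
        (measurableSet_eq_fun (hf.measurable_mk.comp measurable_snd) measurable_fst)
    rw [compProd_map_condDistrib aemeasurable_id, ae_map_iff (hf.prodMk aemeasurable_id) hmeas]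
    filter_upwards [measure_eq_zero_iff_ae_notMem.1 hAfull, hf.ae_eq_mk] with m h₁ h₂
    exact ⟨h₁, h₂.symm⟩
  filter_upwards [Measure.ae_ae_of_ae_compProd hfull] with n hn
  filter_upwards [hn] with m hm
  have h := not_not.1 fun h => hm.1 (hAsub h)
  exact ⟨h.1.trans hm.2, h.2⟩

/-- Almost every point of an image measure lies in the image. -/
theorem ae_map_mem_range [StandardBorelSpace M] [StandardBorelSpace N]
    {ν : Measure M} [IsProbabilityMeasure ν] {f : M → N} (hf : AEMeasurable f ν) :
    ∀ᵐ n ∂ν.map f, n ∈ Set.range f := by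
  have : Nonempty M := nonempty_of_isProbabilityMeasure ν
  filter_upwards [ae_condDistrib_fiber hf (p := fun _ => True) (by simp)] with n hn
  obtain ⟨m, hm⟩ := hn.exists
  exact ⟨m, hm.1⟩

theorem integrable_of_abs_le {μ : Measure Θ} [IsFiniteMeasure μ] {f : Θ → ℝ} (hf : Measurable f)
    {B : ℝ} (hB : ∀ θ, |f θ| ≤ B) : Integrable f μ :=
  Integrable.of_bound hf.aestronglyMeasurable B (Filter.Eventually.of_forall hB)

/-- An inequality between expectations that holds under almost all conditional laws `η m`
holds under their mixture. -/
theorem integral_bind_mono {ρ : Measure M} {η : Kernel M Θ}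
    [IsFiniteMeasure (ρ.bind η)] {f g : Θ → ℝ} (hf : Measurable f) (hg : Measurable g)
    {B C : ℝ} (hB : ∀ θ, |f θ| ≤ B) (hC : ∀ θ, |g θ| ≤ C)
    (h : ∀ᵐ m ∂ρ, ∫ θ, f θ ∂η m ≤ ∫ θ, g θ ∂η m) :
    ∫ θ, f θ ∂(ρ.bind η) ≤ ∫ θ, g θ ∂(ρ.bind η) := by
  have hfi : Integrable f (ρ.bind η) := integrable_of_abs_le hf hB
  have hgi : Integrable g (ρ.bind η) := integrable_of_abs_le hg hC
  rw [Measure.comp_eq_comp_const_apply] at hfi hgi ⊢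
  rw [Kernel.integral_comp hfi, Kernel.integral_comp hgi]
  have hfi' := hfi.integral_comp
  have hgi' := hgi.integral_comp
  rw [Kernel.const_apply] at hfi' hgi' ⊢
  exact integral_mono_ae hfi' hgi' h

end MeasureTheory

/-! ### Transfer of continuation equilibria -/

section Transfer

variable {Θ : Type u} [MeasurableSpace Θ] {J : Type u} {X Y : J → Type u}
  [∀ j, MeasurableSpace (X j)] [∀ j, MeasurableSpace (Y j)] {F : ∀ j, X j → Set (Y j)}
  {G G' : ∀ j, Contract (F j)} {c : Play Θ G} {c' : Play Θ G'} {μ : Measure Θ}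
  {E : Environment Θ X Y} {𝒢 𝒢' : SpaceProfile F}

theorem measurable_chosen (G : ∀ j, Contract (F j)) : Measurable (chosen G) :=
  measurable_pi_lambda _ fun k => (G k).measurable_toFun.comp (measurable_pi_apply k)

theorem Environment.measurable_agent_state (E : Environment Θ X Y) (θ : Θ) :
    Measurable fun a : (∀ j, X j) × (∀ j, Y j) => E.agent a.1 a.2 θ :=
  E.measurable_agent.comp (measurable_fst.prodMk (measurable_snd.prodMk measurable_const))

theorem Environment.measurable_principal_state (E : Environment Θ X Y) (j : J) (θ : Θ) :
    Measurable fun a : (∀ j, X j) × (∀ j, Y j) => E.principal j a.1 a.2 θ :=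
  (E.measurable_principal j).comp
    (measurable_fst.prodMk (measurable_snd.prodMk measurable_const))

theorem Environment.measurable_principal_actions (E : Environment Θ X Y) (j : J)
    (x : ∀ j, X j) (y : ∀ j, Y j) : Measurable (E.principal j x y) :=
  (E.measurable_principal j).comp
    (measurable_const.prodMk (measurable_const.prodMk measurable_id))

namespace Play.IsMeasurable

theorem aemeasurable_outcome (hc : c.IsMeasurable μ) (θ : Θ) :
    AEMeasurable (fun m => (chosen G m, c.act m)) (c.msg θ) :=
  (measurable_chosen G).aemeasurable.prodMk (hc.act θ)

theorem lintegral_allocation (hc : c.IsMeasurable μ) (θ : Θ)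
    {g : (∀ j, X j) × (∀ j, Y j) → ℝ≥0∞} (hg : Measurable g) :
    ∫⁻ a, g a ∂c.allocation θ = ∫⁻ m, g (chosen G m, c.act m) ∂c.msg θ :=
  lintegral_map' hg.aemeasurable (hc.aemeasurable_outcome θ)

theorem integral_allocation (hc : c.IsMeasurable μ) (θ : Θ)
    {g : (∀ j, X j) × (∀ j, Y j) → ℝ} (hg : Measurable g) :
    ∫ a, g a ∂c.allocation θ = ∫ m, g (chosen G m, c.act m) ∂c.msg θ :=
  integral_map (hc.aemeasurable_outcome θ) hg.aestronglyMeasurable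

theorem integrable_allocation_iff (hc : c.IsMeasurable μ) (θ : Θ)
    {g : (∀ j, X j) × (∀ j, Y j) → ℝ} (hg : Measurable g) :
    Integrable g (c.allocation θ) ↔ Integrable (fun m => g (chosen G m, c.act m)) (c.msg θ) :=
  integrable_map_measure hg.aestronglyMeasurable (hc.aemeasurable_outcome θ)

theorem value_eq (hc : c.IsMeasurable μ) (hc' : c'.IsMeasurable μ)
    (h : c'.allocation = c.allocation) (j : J) : c'.value E j = c.value E j := by
  unfold Play.value
  congr 1
  ext θ
  have hg := E.measurable_principal_state j θ
  rw [← hc'.integral_allocation θ hg, ← hc.integral_allocation θ hg, h]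

end Play.IsMeasurable

/-- All equilibrium conditions except the ones on the beliefs depend only on the allocation and
on the outcomes available to the agent. -/
theorem IsContinuationEquilibrium.transfer [DecidableEq J]
    (hc : IsContinuationEquilibrium E 𝒢 G c)
    (hmem : ∀ j, G' j ∈ 𝒢' j) (hmeas : c'.IsMeasurable E.prior) (hbayes : c'.IsBayesian E.prior)
    (halloc : c'.allocation = c.allocation)
    (hout : ∀ m', ∃ m, chosen G m = chosen G' m' ∧ c.act m = c'.act m')
    (hopt : ∀ (j : J) (m : MsgProfile G'), ∀ y ∈ F j (chosen G' m j),
      ∫ θ, E.principal j (chosen G' m) (Function.update (c'.act m) j y) θ ∂(c'.belief j m) ≤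
        ∫ θ, E.principal j (chosen G' m) (c'.act m) θ ∂(c'.belief j m)) :
    IsContinuationEquilibrium E 𝒢' G' c' := by
  have hu : ∀ θ, ∫ m, E.agent (chosen G' m) (c'.act m) θ ∂(c'.msg θ) =
      ∫ m, E.agent (chosen G m) (c.act m) θ ∂(c.msg θ) := by
    intro θ
    have hg := E.measurable_agent_state θ
    rw [← hmeas.integral_allocation θ hg, ← hc.measurable.integral_allocation θ hg, halloc]
  refine ⟨hmem, hmeas, hbayes, ?_, ?_, ?_, ?_, hopt⟩
  · intro θ
    have hg := E.measurable_agent_state θ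
    rw [← hmeas.integrable_allocation_iff θ hg, halloc,
      hc.measurable.integrable_allocation_iff θ hg]
    exact hc.agent_integrable θ
  · intro θ
    rw [hu]
    exact hc.agent_participation θ
  · intro θ m'
    obtain ⟨m, h₁, h₂⟩ := hout m'
    rw [hu, ← h₁, ← h₂]
    exact hc.agent_optimal θ m
  · intro j
    convert hc.principal_integrable j using 3 with θ
    have hg := (E.measurable_principal_state j θ).enorm
    rw [← hmeas.lintegral_allocation θ hg, ← hc.measurable.lintegral_allocation θ hg, halloc]

/-- Bayesian consistency in terms of the law of the message profile. -/
theorem Play.isBayesian_iff (hmsg : AEMeasurable c.msg μ)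
    (hbel : ∀ j, AEMeasurable (c.belief j) (μ.bind c.msg)) :
    c.IsBayesian μ ↔ ∀ (j : J) (E₁ : Set Θ) (E₂ : Set (MsgProfile G)),
      MeasurableSet E₁ → MeasurableSet E₂ →
      ∫⁻ θ in E₁, c.msg θ E₂ ∂μ = ∫⁻ m in E₂, c.belief j m E₁ ∂(μ.bind c.msg) := by
  refine forall_congr' fun j => forall_congr' fun E₁ => forall_congr' fun E₂ =>
    forall_congr' fun h₁ => forall_congr' fun h₂ => ?_
  have hm : AEMeasurable (fun m => E₂.indicator (fun m => c.belief j m E₁) m)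
      (μ.bind c.msg) :=
    ((Measure.measurable_coe h₁).comp_aemeasurable (hbel j)).indicator h₂
  have h : ∫⁻ m in E₂, c.belief j m E₁ ∂(μ.bind c.msg) =
      ∫⁻ θ, ∫⁻ m in E₂, c.belief j m E₁ ∂(c.msg θ) ∂μ := by
    rw [← lintegral_indicator h₂, Measure.lintegral_bind hmsg hm]
    simp_rw [lintegral_indicator h₂]
  rw [h]

/-- Bayesian consistency is preserved when the messages are relabelled by `f`, if the new beliefs
have the same averages over sets of new messages. -/
theorem Play.isBayesian_of_map (hc : c.IsMeasurable μ) (hb : c.IsBayesian μ)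
    {f : MsgProfile G → MsgProfile G'} (hf : AEMeasurable f (μ.bind c.msg))
    (hmsg : c'.msg = fun θ => (c.msg θ).map f)
    (hbel : ∀ j, AEMeasurable (c'.belief j) ((μ.bind c.msg).map f))
    (h : ∀ (j : J) (E₁ : Set Θ) (E₂ : Set (MsgProfile G')), MeasurableSet E₁ → MeasurableSet E₂ →
      ∫⁻ m, E₂.indicator (fun _ => c.belief j m E₁) (f m) ∂(μ.bind c.msg) =
        ∫⁻ m in E₂, c'.belief j m E₁ ∂((μ.bind c.msg).map f)) :
    c'.IsBayesian μ := by
  have hbind : μ.bind c'.msg = (μ.bind c.msg).map f := by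
    rw [hmsg, bind_map_eq hc.msg hf]
  rw [Play.isBayesian_iff (hmsg ▸ aemeasurable_map_bind hc.msg hf) (hbind ▸ hbel)]
  intro j E₁ E₂ h₁ h₂
  have hmk : ∫⁻ m, E₂.indicator (fun _ => c.belief j m E₁) (f m) ∂(μ.bind c.msg) =
      ∫⁻ m in hf.mk f ⁻¹' E₂, c.belief j m E₁ ∂(μ.bind c.msg) := by
    rw [← lintegral_indicator (hf.measurable_mk h₂)]
    refine lintegral_congr_ae ?_
    filter_upwards [hf.ae_eq_mk] with m hm
    rw [hm]
    rfl
  rw [hbind, ← h j E₁ E₂ h₁ h₂, hmk, ← (Play.isBayesian_iff hc.msg hc.belief).1 hb j E₁ _ h₁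
    (hf.measurable_mk h₂)]
  refine lintegral_congr_ae (ae_restrict_of_ae ?_)
  filter_upwards [Measure.ae_ae_of_ae_bind hc.msg hf.ae_eq_mk] with θ hθ
  rw [congrFun hmsg θ, Measure.map_congr hθ, Measure.map_apply hf.measurable_mk h₂]

/-- If the messages to `G'` encode the messages to `G`, every continuation equilibrium
of `G` can be played in `G'`. -/
theorem IsContinuationEquilibrium.exists_of_decode [DecidableEq J]
    (hc : IsContinuationEquilibrium E 𝒢 G c) (hmem : ∀ j, G' j ∈ 𝒢' j)
    {ψ : MsgProfile G' → MsgProfile G} {ρ : MsgProfile G → MsgProfile G'}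
    (hψ : Measurable ψ) (hρ : Measurable ρ) (hψρ : ∀ m, ψ (ρ m) = m)
    (hchosen : ∀ m', chosen G (ψ m') = chosen G' m') :
    ∃ c' : Play Θ G', IsContinuationEquilibrium E 𝒢' G' c' ∧ c'.allocation = c.allocation := by
  let c' : Play Θ G' :=
    { act := fun m' => c.act (ψ m')
      act_mem := fun m' j => hchosen m' ▸ c.act_mem (ψ m') j
      msg := fun θ => (c.msg θ).map ρ
      isProbabilityMeasure_msg := fun θ => Measure.isProbabilityMeasure_map hρ.aemeasurable
      belief := fun j m' => c.belief j (ψ m')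
      isProbabilityMeasure_belief := fun j m' => inferInstance }
  have hψρ' : ψ ∘ ρ = id := funext hψρ
  have hcomp : ∀ {Z : Type u} [MeasurableSpace Z] {g : MsgProfile G → Z}
      {κ : Measure (MsgProfile G)}, AEMeasurable g κ → AEMeasurable (fun m' => g (ψ m'))
        (κ.map ρ) := by
    intro Z _ g κ hg
    refine AEMeasurable.comp_measurable ?_ hψ
    rwa [Measure.map_map hψ hρ, hψρ', Measure.map_id]
  have hbind : E.prior.bind c'.msg = (E.prior.bind c.msg).map ρ :=
    bind_map_eq hc.measurable.msg hρ.aemeasurable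
  have hmeas : c'.IsMeasurable E.prior := by
    refine ⟨aemeasurable_map_bind hc.measurable.msg hρ.aemeasurable,
      fun θ => hcomp (hc.measurable.act θ), ?_, fun j => ?_⟩
    · rw [hbind]
      exact hcomp hc.measurable.act_bind
    · rw [hbind]
      exact hcomp (hc.measurable.belief j)
  have halloc : c'.allocation = c.allocation := by
    ext1 θ
    have h := hmeas.aemeasurable_outcome θ
    change Measure.map _ (Measure.map ρ (c.msg θ)) = Measure.map _ (c.msg θ)
    rw [AEMeasurable.map_map_of_aemeasurable h hρ.aemeasurable]
    congr 1
    ext1 m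
    change (chosen G' (ρ m), c.act (ψ (ρ m))) = _
    rw [← hchosen, hψρ]
  refine ⟨c', hc.transfer hmem hmeas ?_ halloc (fun m' => ⟨ψ m', hchosen m', rfl⟩) ?_, halloc⟩
  · refine Play.isBayesian_of_map hc.measurable hc.bayesian hρ.aemeasurable rfl
      (fun j => hcomp (hc.measurable.belief j)) ?_
    intro j E₁ E₂ h₁ h₂
    have hb : AEMeasurable (fun m' => c'.belief j m' E₁) ((E.prior.bind c.msg).map ρ) :=
      (Measure.measurable_coe h₁).comp_aemeasurable (hcomp (hc.measurable.belief j))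
    rw [← lintegral_indicator h₂, lintegral_map' (hb.indicator h₂) hρ.aemeasurable]
    refine lintegral_congr fun m => ?_
    have hbm : c'.belief j (ρ m) E₁ = c.belief j m E₁ :=
      congrArg (fun m => c.belief j m E₁) (hψρ m)
    simp only [Set.indicator, hbm]
  · intro j m' y hy
    have h := hc.principal_optimal j (ψ m') y
    rw [hchosen m'] at h
    exact h hy

end Transfer

/-! ### From arbitrary contracts to menus with recommendations -/

section ToMenu

variable {Θ : Type u} [MeasurableSpace Θ] {J : Type u}
  {X Y : J → Type u}
  [∀ j, MeasurableSpace (X j)] [∀ j, StandardBorelSpace (X j)]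
  [∀ j, MeasurableSpace (Y j)] [∀ j, StandardBorelSpace (Y j)] {F : ∀ j, X j → Set (Y j)}
  {G : ∀ j, Contract (F j)} {c : Play Θ G} {μ : Measure Θ}
  {E : Environment Θ X Y} {𝒢 𝒢' : SpaceProfile F}

/-- The profile of menus with recommendations that offers the same contractible actions as `G`. -/
abbrev menuProfile (G : ∀ j, Contract (F j)) : ∀ j, Contract (F j) := fun j => (G j).toMenu

theorem toMenu_mem_menuSpace {j : J} (C : Contract (F j)) : C.toMenu ∈ menuSpace F j :=
  ⟨_, _, rfl⟩

/-- The message profile of `menuProfile G` that names the outcome of `m` in the play `c`. -/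
def Play.outcomeMsg (c : Play Θ G) (m : MsgProfile G) : MsgProfile (menuProfile G) :=
  fun k => (⟨(chosen G m k, c.act m k), ⟨m k, rfl⟩, c.act_mem m k⟩ :
    feasiblePairs (F k) (Set.range (G k).toFun))

/-- The non-contractible actions recommended by a message profile of `menuProfile G`. -/
def recommended (n : MsgProfile (menuProfile G)) : ∀ k, Y k :=
  fun k => (show feasiblePairs (F k) (Set.range (G k).toFun) from n k).1.2

theorem measurable_recommended :
    Measurable (recommended : MsgProfile (menuProfile G) → ∀ k, Y k) :=
  measurable_pi_lambda _ fun k =>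
    (measurable_snd.comp measurable_subtype_coe :
      Measurable fun a : feasiblePairs (F k) (Set.range (G k).toFun) => a.1.2).comp
        (measurable_pi_apply k)

theorem Play.aemeasurable_outcomeMsg [Countable J] {κ : Measure (MsgProfile G)}
    (h : AEMeasurable c.act κ) :
    AEMeasurable c.outcomeMsg κ := by
  refine aemeasurable_pi_lambda _ fun k => ?_
  have hk : AEMeasurable (fun m => (chosen G m k, c.act m k)) κ :=
    ((measurable_pi_apply k).comp (measurable_chosen G)).aemeasurable.prodMk
      ((measurable_pi_apply k).comp_aemeasurable h)
  exact hk.subtype_mk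

/-- Every message profile of `menuProfile G` leads to the same contractible actions as some message
profile of `G`, which has the recommended outcome whenever some message profile has it. -/
theorem Play.exists_msg_of_menuProfile (c : Play Θ G) (n : MsgProfile (menuProfile G)) :
    ∃ m, chosen G m = chosen (menuProfile G) n ∧ (n ∈ Set.range c.outcomeMsg →
      c.outcomeMsg m = n) := by
  by_cases h : n ∈ Set.range c.outcomeMsg
  · obtain ⟨m, rfl⟩ := h
    exact ⟨m, rfl, fun _ => rfl⟩
  · have hn : ∀ k, ∃ a, (G k).toFun a = chosen (menuProfile G) n k := fun k =>
      (show feasiblePairs (F k) (Set.range (G k).toFun) from n k).2.1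
    choose m hm using hn
    exact ⟨m, funext hm, fun h' => (h h').elim⟩

/-- The agent replaces every message profile by the outcome it leads to. The principals follow
recommendations that some original message profile would have led to, and their new belief is the
average of the old beliefs at these profiles. Each of the old beliefs makes the recommended action
optimal, hence so does the average. -/
theorem IsContinuationEquilibrium.exists_menuProfile [Countable J] [DecidableEq J]
    (hc : IsContinuationEquilibrium E 𝒢 G c) (hmem : ∀ j, (G j).toMenu ∈ 𝒢' j) :
    ∃ c' : Play Θ (menuProfile G),
      IsContinuationEquilibrium E 𝒢' (menuProfile G) c' ∧ c'.allocation = c.allocation := by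
  classical
  choose σ hσ hσ' using c.exists_msg_of_menuProfile
  set φ := c.outcomeMsg
  set ν := E.prior.bind c.msg
  have : IsProbabilityMeasure ν := isProbabilityMeasure_bind hc.measurable.msg
  have : Nonempty (MsgProfile G) := nonempty_of_isProbabilityMeasure ν
  have hφν : AEMeasurable φ ν := Play.aemeasurable_outcomeMsg hc.measurable.act_bind
  have hφθ : ∀ θ, AEMeasurable φ (c.msg θ) := fun θ =>
    Play.aemeasurable_outcomeMsg (hc.measurable.act θ)
  -- `η j` is a measurable version of the beliefs `c.belief j`.
  let η : ∀ j, Kernel (MsgProfile G) Θ := fun j =>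
    ⟨(hc.measurable.belief j).mk, (hc.measurable.belief j).measurable_mk⟩
  have hη : ∀ᵐ m ∂ν, ∀ j, c.belief j m = η j m :=
    ae_all_iff.2 fun j => (hc.measurable.belief j).ae_eq_mk
  let κ := condDistrib id φ ν
  -- At the reports in `Good` the averaged belief inherits optimality from the old beliefs. The other
  -- reports form a null set for the prior, but perhaps not for every single type, so that the
  -- recommendation must be followed there too whenever it is an outcome; the belief is then the
  -- old belief at `σ n`.
  let Good : MsgProfile (menuProfile G) → Prop := fun n =>
    ∀ᵐ m ∂κ n, φ m = n ∧ ∀ j, c.belief j m = η j m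
  have hGood : ∀ᵐ n ∂ν.map φ, Good n := ae_condDistrib_fiber hφν hη
  have hbindprob : ∀ n, Good n → ∀ j, IsProbabilityMeasure ((κ n).bind (η j)) := by
    refine fun n hn j => ⟨?_⟩
    rw [Measure.bind_apply MeasurableSet.univ (η j).measurable.aemeasurable]
    have h : ∀ᵐ m ∂κ n, η j m Set.univ = 1 := by
      filter_upwards [hn] with m hm
      rw [← hm.2 j]
      exact measure_univ
    rw [lintegral_congr_ae h]
    simp
  have hact : ∀ n ∈ Set.range φ, c.act (σ n) = recommended n := fun n hn =>
    congrArg recommended (hσ' n hn)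
  let c' : Play Θ (menuProfile G) :=
    { act := fun n => c.act (σ n)
      act_mem := fun n j => hσ n ▸ c.act_mem (σ n) j
      msg := fun θ => (c.msg θ).map φ
      isProbabilityMeasure_msg := fun θ => Measure.isProbabilityMeasure_map (hφθ θ)
      belief := fun j n => if Good n then (κ n).bind (η j) else c.belief j (σ n)
      isProbabilityMeasure_belief := fun j n => by
        split_ifs with h
        · exact hbindprob n h j
        · infer_instance }
  have hbind : E.prior.bind c'.msg = ν.map φ := bind_map_eq hc.measurable.msg hφν
  have hactae : ∀ (ρ : Measure (MsgProfile G)) [IsProbabilityMeasure ρ], AEMeasurable φ ρ →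
      c'.act =ᵐ[ρ.map φ] recommended := by
    intro ρ _ hρ
    filter_upwards [ae_map_mem_range hρ] with n hn
    exact hact n hn
  have hbelae : ∀ j, c'.belief j =ᵐ[ν.map φ] fun n => (κ n).bind (η j) := by
    intro j
    filter_upwards [hGood] with n hn
    exact if_pos hn
  have hbelmeas : ∀ j, AEMeasurable (c'.belief j) (ν.map φ) := fun j =>
    ⟨_, (Measure.measurable_bind' (η j).measurable).comp κ.measurable, hbelae j⟩
  have hmeas : c'.IsMeasurable E.prior := by
    refine ⟨aemeasurable_map_bind hc.measurable.msg hφν,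
      fun θ => ⟨_, measurable_recommended, hactae _ (hφθ θ)⟩, ?_, ?_⟩
    · rw [hbind]
      exact ⟨_, measurable_recommended, hactae ν hφν⟩
    · rw [hbind]
      exact hbelmeas
  have halloc : c'.allocation = c.allocation := by
    ext1 θ
    have h := hmeas.aemeasurable_outcome θ
    change Measure.map _ (Measure.map φ (c.msg θ)) = Measure.map _ (c.msg θ)
    rw [AEMeasurable.map_map_of_aemeasurable h (hφθ θ)]
    congr 1
    ext1 m
    change (_, c.act (σ (φ m))) = _
    rw [hact _ ⟨m, rfl⟩]
    rfl
  refine ⟨c', hc.transfer hmem hmeas ?_ halloc (fun n => ⟨σ n, hσ n, rfl⟩) ?_, halloc⟩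
  · refine Play.isBayesian_of_map hc.measurable hc.bayesian hφν rfl hbelmeas ?_
    intro j E₁ E₂ h₁ h₂
    have hηmeas : Measurable fun x : MsgProfile (menuProfile G) × MsgProfile G => η j x.2 E₁ :=
      ((η j).measurable_coe h₁).comp measurable_snd
    have hright : ∫⁻ n in E₂, c'.belief j n E₁ ∂(ν.map φ) =
        ∫⁻ n in E₂, ∫⁻ m in Set.univ, η j m E₁ ∂(κ n) ∂(ν.map φ) := by
      refine lintegral_congr_ae (ae_restrict_of_ae ?_)
      filter_upwards [hbelae j] with n hn
      rw [hn, Measure.bind_apply h₁ (η j).measurable.aemeasurable, Measure.restrict_univ]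
    rw [hright, ← Measure.setLIntegral_compProd hηmeas h₂ MeasurableSet.univ,
      compProd_map_condDistrib aemeasurable_id,
      ← lintegral_indicator (h₂.prod MeasurableSet.univ),
      lintegral_map' (hηmeas.indicator (h₂.prod MeasurableSet.univ)).aemeasurable
        (hφν.prodMk aemeasurable_id)]
    refine lintegral_congr_ae ?_
    filter_upwards [hη] with m hm
    simp [Set.indicator, hm j]
  · intro j n y hy
    by_cases hn : Good n
    · have hbel : c'.belief j n = (κ n).bind (η j) := if_pos hn
      have := hbindprob n hn j
      obtain ⟨m₀, hm₀⟩ := Filter.Eventually.exists hn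
      have hactn : c'.act n = recommended n := hact n ⟨m₀, hm₀.1⟩
      -- Boundedness in the state makes both expected payoffs finite under the averaged belief.
      obtain ⟨B, hB⟩ := E.principal_bounded j (chosen (menuProfile G) n)
        (Function.update (c'.act n) j y)
      obtain ⟨C, hC⟩ := E.principal_bounded j (chosen (menuProfile G) n) (c'.act n)
      rw [hbel]
      refine integral_bind_mono (E.measurable_principal_actions _ _ _)
        (E.measurable_principal_actions _ _ _) hB hC ?_
      filter_upwards [hn] with m hm
      have hm' := hm.1
      rw [← hm.2 j, hactn]
      subst hm'
      exact hc.principal_optimal j m y hy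
    · have hbel : c'.belief j n = c.belief j (σ n) := if_neg hn
      have h := hc.principal_optimal j (σ n) y
      rw [hσ n] at h
      rw [hbel]
      exact h hy

end ToMenu

/-! ### Canonicity of menus with recommendations -/

section Canonical

variable {Θ : Type u} [MeasurableSpace Θ] {J : Type u} [DecidableEq J] {X Y : J → Type u}
  [∀ j, MeasurableSpace (X j)] [∀ j, MeasurableSpace (Y j)] {F : ∀ j, X j → Set (Y j)}
  {E : Environment Θ X Y} {𝒢 𝒢' : SpaceProfile F} {G : ∀ j, Contract (F j)} {c : Play Θ G}

theorem IsContinuationEquilibrium.of_mem (hc : IsContinuationEquilibrium E 𝒢 G c)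
    (h : ∀ j, G j ∈ 𝒢' j) : IsContinuationEquilibrium E 𝒢' G c :=
  { hc with mem := h }

/-- The largest contract space allows the most deviations, so it alone decides whether an equilibrium
is unrestricted robust. -/
theorem isUnrestrictedRobustEquilibrium_iff :
    IsUnrestrictedRobustEquilibrium E G c ↔ IsRobustEquilibrium E (fun _ => Set.univ) G c := by
  refine ⟨fun h => h _ (fun j => ⟨G j, trivial⟩) fun _ => trivial, fun h 𝒢 _ hG => ?_⟩
  refine ⟨h.1.of_mem hG, fun j G' hG' => ?_⟩
  obtain ⟨c', hc', hv⟩ := h.2 j G' trivial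
  refine ⟨c', hc'.of_mem fun k => ?_, hv⟩
  rcases eq_or_ne k j with rfl | hk
  · rwa [Function.update_self]
  · rw [Function.update_of_ne hk]
    exact hG k

variable [∀ j, StandardBorelSpace (X j)] [∀ j, StandardBorelSpace (Y j)]

/-- Every equilibrium outcome can be replayed in menus with recommendations, on path and after every
deviation to a menu. -/
theorem unrestrictedRobustAllocations_subset [Countable J] (E : Environment Θ X Y) :
    unrestrictedRobustAllocations F E ⊆ robustAllocations E (menuSpace F) := by
  rintro z ⟨G, c, h, rfl⟩
  rw [isUnrestrictedRobustEquilibrium_iff] at h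
  obtain ⟨d, hd, hdc⟩ := h.1.exists_menuProfile (𝒢' := menuSpace F) fun j =>
    toMenu_mem_menuSpace (G j)
  refine ⟨menuProfile G, d, ⟨hd, fun j G' hG' => ?_⟩, hdc⟩
  obtain ⟨c', hc', hv⟩ := h.2 j G' trivial
  have hG : menuProfile (Function.update G j G') = Function.update (menuProfile G) j G' := by
    obtain ⟨L, hL, rfl⟩ := hG'
    funext k
    rcases eq_or_ne k j with rfl | hk
    · simp only [menuProfile, Function.update_self, toMenu_menuContract]
    · simp only [menuProfile, Function.update_of_ne hk]
  obtain ⟨d', hd', hdc'⟩ := hc'.exists_menuProfile (𝒢' := menuSpace F) fun j =>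
    toMenu_mem_menuSpace _
  have hex : ∃ d' : Play Θ (menuProfile (Function.update G j G')),
      IsContinuationEquilibrium E (menuSpace F) (menuProfile (Function.update G j G')) d' ∧
        d'.value E j ≤ d.value E j := by
    refine ⟨d', hd', ?_⟩
    rwa [hc'.measurable.value_eq hd'.measurable hdc', h.1.measurable.value_eq hd.measurable hdc]
  rwa [hG] at hex

/-- Principal `j` offers `P' j` and the others offer `P k` with cheap talk. The agent can then play
as if principal `j` offered the menu with recommendations of `P' j`: the recommendation to `j` is
sent through the cheap talk with another principal `i`. -/
theorem exists_decode_of_talk {P P' : ∀ k, Contract (F k)} {j i : J} (hij : i ≠ j)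
    [∀ k, Nonempty (Y k)] [Countable J]
    (hj : P j = (P' j).toMenu) (hne : ∀ k, k ≠ j → P' k = (P k).withTalk (∀ k, Y k)) :
    ∃ (ψ : MsgProfile P' → MsgProfile P) (ρ : MsgProfile P → MsgProfile P'),
      Measurable ψ ∧ Measurable ρ ∧ (∀ m, ψ (ρ m) = m) ∧
        ∀ m', chosen P (ψ m') = chosen P' m' := by
  classical
  have hdev : ∀ C C' : Contract (F j), C = C'.toMenu →
      ∃ (dec : (∀ k, Y k) × C'.Msg → C.Msg) (enc : (∀ k, Y k) × C.Msg → C'.Msg)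
        (rcm : C.Msg → ∀ k, Y k), Measurable dec ∧ Measurable enc ∧ Measurable rcm ∧
          (∀ a, C.toFun (dec a) = C'.toFun a.2) ∧ ∀ m, dec (rcm m, enc (rcm m, m)) = m := by
    rintro C C' rfl
    obtain ⟨dec, enc, rcm, hdec, henc, hrcm, hto, hinv⟩ := C'.exists_decode_toMenu
    refine ⟨fun a => dec (a.1 j, a.2), fun a => enc a.2,
      fun m => Function.update (fun _ => Classical.arbitrary _) j (rcm m),
      hdec.comp (((measurable_pi_apply j).comp measurable_fst).prodMk measurable_snd),
      henc.comp measurable_snd, (measurable_update _).comp hrcm, fun a => hto _, fun m => ?_⟩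
    simp only [Function.update_self, hinv]
  obtain ⟨dec₀, enc₀, rcm, hdec₀, henc₀, hrcm, hto₀, hinv₀⟩ := hdev _ _ hj
  have hoth : ∀ k, ∀ C C' : Contract (F k), C' = C.withTalk (∀ k, Y k) →
      ∃ (dec : (∀ k, Y k) × C'.Msg → C.Msg) (enc : (∀ k, Y k) × C.Msg → C'.Msg)
        (talk : C'.Msg → ∀ k, Y k), Measurable dec ∧ Measurable enc ∧ Measurable talk ∧
          (∀ a, C.toFun (dec a) = C'.toFun a.2) ∧ (∀ r m, dec (r, enc (r, m)) = m) ∧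
            ∀ r m, talk (enc (r, m)) = r := by
    rintro k C C' rfl
    exact ⟨fun a => (show C.Msg × (∀ k, Y k) from a.2).1, fun a => (a.2, a.1),
      fun a => (show C.Msg × (∀ k, Y k) from a).2, measurable_fst.comp measurable_snd,
      measurable_snd.prodMk measurable_fst, measurable_snd, fun _ => rfl, fun _ _ => rfl,
      fun _ _ => rfl⟩
  have hall : ∀ k, ∃ (dec : (∀ k, Y k) × (P' k).Msg → (P k).Msg)
      (enc : (∀ k, Y k) × (P k).Msg → (P' k).Msg), Measurable dec ∧ Measurable enc ∧
        (∀ a, (P k).toFun (dec a) = (P' k).toFun a.2) ∧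
        (∀ m : MsgProfile P, dec (rcm (m j), enc (rcm (m j), m k)) = m k) ∧
        (k ≠ j → ∃ talk : (P' k).Msg → ∀ k, Y k, Measurable talk ∧
          ∀ r m, talk (enc (r, m)) = r) := by
    intro k
    rcases eq_or_ne k j with rfl | hk
    · exact ⟨dec₀, enc₀, hdec₀, henc₀, hto₀, fun m => hinv₀ (m k), fun h => (h rfl).elim⟩
    · obtain ⟨dec, enc, talk, hdec, henc, htalk, hto, hinv, hinv'⟩ := hoth k _ _ (hne k hk)
      exact ⟨dec, enc, hdec, henc, hto, fun m => hinv _ _, fun _ => ⟨talk, htalk, hinv'⟩⟩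
  choose dec enc hdec henc hto hinv htalk using hall
  -- Every contract is decoded with the recommendation found in the talk with principal `i`.
  obtain ⟨talk, htalkm, htalk'⟩ := htalk i hij
  refine ⟨fun m' k => dec k (talk (m' i), m' k), fun m k => enc k (rcm (m j), m k),
    measurable_pi_lambda _ fun k => (hdec k).comp
      ((htalkm.comp (measurable_pi_apply i)).prodMk (measurable_pi_apply k)),
    measurable_pi_lambda _ fun k => (henc k).comp
      ((hrcm.comp (measurable_pi_apply j)).prodMk (measurable_pi_apply k)), ?_, ?_⟩
  · intro m
    funext k
    simp only [htalk', hinv]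
  · intro m'
    funext k
    exact hto k _

/-- Adding cheap talk to all menus of a robust equilibrium makes it robust against deviations to
arbitrary contracts. -/
theorem robustAllocations_menuSpace_subset [Countable J] [Nontrivial J] [∀ k, Nonempty (Y k)]
    (E : Environment Θ X Y) :
    robustAllocations E (menuSpace F) ⊆ unrestrictedRobustAllocations F E := by
  rintro z ⟨G, c, h, rfl⟩
  let H : ∀ k, Contract (F k) := fun k => (G k).withTalk (∀ k, Y k)
  have hψ : Measurable fun (m' : MsgProfile H) k => ((m' k : (G k).Msg × ∀ k, Y k)).1 :=
    measurable_pi_lambda _ fun k =>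
      (measurable_fst : Measurable (Prod.fst : (G k).Msg × (∀ k, Y k) → _)).comp
        (measurable_pi_apply k)
  have hρ : Measurable fun (m : MsgProfile G) k =>
      (show (H k).Msg from (m k, fun i => Classical.arbitrary (Y i))) :=
    measurable_pi_lambda _ fun k => (measurable_pi_apply k).prodMk measurable_const
  obtain ⟨d, hd, hdc⟩ := h.1.exists_of_decode (G' := H) (𝒢' := fun _ => Set.univ)
    (fun _ => trivial) hψ hρ (fun _ => rfl) fun _ => rfl
  refine ⟨H, d, isUnrestrictedRobustEquilibrium_iff.2 ⟨hd, fun j G' _ => ?_⟩, hdc⟩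
  obtain ⟨c', hc', hv⟩ := h.2 j G'.toMenu (toMenu_mem_menuSpace G')
  obtain ⟨i, hij⟩ := exists_ne j
  obtain ⟨ψ, ρ, hψ', hρ', hψρ, hch⟩ := exists_decode_of_talk
    (P := Function.update G j G'.toMenu) (P' := Function.update H j G') hij
    (by simp only [Function.update_self])
    (fun k hk => by simp only [Function.update_of_ne hk, H])
  obtain ⟨d', hd', hdc'⟩ := hc'.exists_of_decode (G' := Function.update H j G')
    (𝒢' := fun _ => Set.univ) (fun _ => trivial) hψ' hρ' hψρ hch
  refine ⟨d', hd', ?_⟩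
  rwa [hc'.measurable.value_eq hd'.measurable hdc', h.1.measurable.value_eq hd.measurable hdc]

end Canonical

/-! ### Lower bound on the size of canonical contract spaces -/

section Minimal

/-- Standard Borel spaces are Borel isomorphic to countable sets or to the continuum, so a bound on
the cardinality yields a measurable injection. -/
theorem exists_measurable_injective {S T : Type u} [MeasurableSpace S] [StandardBorelSpace S]
    [MeasurableSpace T] [StandardBorelSpace T] (h : Cardinal.mk S ≤ Cardinal.mk T) :
    ∃ e : S → T, Measurable e ∧ Function.Injective e := by
  obtain ⟨f⟩ := h
  by_cases hS : Countable S
  · exact ⟨f, measurable_of_countable _, f.injective⟩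
  · have hT : ¬ Countable T := fun _ => hS f.injective.countable
    let e := PolishSpace.measurableEquivOfNotCountable hS hT
    exact ⟨e, e.measurable, e.injective⟩

variable {Θ : Type u} [MeasurableSpace Θ] [StandardBorelSpace Θ] {J : Type u}
  {X Y : J → Type u} [∀ j, MeasurableSpace (X j)] [∀ j, MeasurableSpace (Y j)]

open Classical in
/-- The environment in which principals are indifferent, the prior is concentrated on `θ₀`, and the
agent of type `e x` wants principal `j` to choose `x` and cares for nothing else. -/
noncomputable def revealingEnvironment (X Y : J → Type u) [∀ j, MeasurableSpace (X j)]
    [∀ j, MeasurableSpace (Y j)] (θ₀ : Θ) (j : J) (e : X j → Θ) (he : Measurable e) :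
    Environment Θ X Y where
  prior := Measure.dirac θ₀
  isProbabilityMeasure_prior := inferInstance
  outside := fun _ => 0
  measurable_outside := measurable_const
  agent := fun x _ θ => if θ = e (x j) then 1 else 0
  measurable_agent := Measurable.ite
    (measurableSet_eq_fun (measurable_snd.comp measurable_snd)
      (he.comp ((measurable_pi_apply j).comp measurable_fst))) measurable_const measurable_const
  principal := fun _ _ _ _ => 0
  measurable_principal := fun _ => measurable_const
  principal_bounded := fun _ _ _ => ⟨0, fun _ => by simp⟩

variable {F : ∀ j, X j → Set (Y j)} {θ₀ : Θ} {j : J} {e : X j → Θ} {he : Measurable e}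
  {G : ∀ j, Contract (F j)}

theorem revealingEnvironment_value (c : Play Θ G) (k : J) :
    c.value (revealingEnvironment X Y θ₀ j e he) k = 0 := by
  simp [Play.value, revealingEnvironment]

/-- With two utility levels every type has an optimal message profile, and since the prior is
degenerate any choice of optimal message profiles is measurable. -/
theorem exists_isContinuationEquilibrium_revealing [Countable J] [DecidableEq J]
    (hF : ∀ j x, (F j x).Nonempty) (G : ∀ j, Contract (F j)) :
    ∃ c : Play Θ G, IsContinuationEquilibrium (revealingEnvironment X Y θ₀ j e he)
      (fun _ => Set.univ) G c := by
  classical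
  let a : Θ → MsgProfile G → ℝ := fun θ m => if θ = e (chosen G m j) then 1 else 0
  have hbest : ∀ θ, ∃ m, ∀ m', a θ m' ≤ a θ m := by
    intro θ
    by_cases h : ∃ m, θ = e (chosen G m j)
    · obtain ⟨m, hm⟩ := h
      refine ⟨m, fun m' => ?_⟩
      simp only [a]
      rw [if_pos hm]
      split_ifs <;> norm_num
    · push Not at h
      exact ⟨fun _ => Classical.arbitrary _, fun m' => by simp only [a, if_neg (h _), le_refl]⟩
  choose best hbest using hbest
  choose y hy using hF
  let c : Play Θ G :=
    { act := fun m k => y k (chosen G m k)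
      act_mem := fun m k => hy k _
      msg := fun θ => Measure.dirac (best θ)
      isProbabilityMeasure_msg := fun _ => inferInstance
      belief := fun _ _ => Measure.dirac θ₀
      isProbabilityMeasure_belief := fun _ _ => inferInstance }
  have hbind : (Measure.dirac θ₀).bind c.msg = Measure.dirac (best θ₀) := by
    have h : c.msg =ᵐ[Measure.dirac θ₀] fun _ => Measure.dirac (best θ₀) := by
      rw [Filter.EventuallyEq, ae_dirac_eq]
      exact Filter.eventually_pure.2 rfl
    rw [Measure.bind_congr_right h, Measure.bind_const, measure_univ, one_smul]
  have hu : ∀ θ, ∫ m, (revealingEnvironment X Y θ₀ j e he).agent (chosen G m) (c.act m) θ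
      ∂(c.msg θ) = a θ (best θ) := fun θ => integral_dirac _ _
  refine ⟨c, fun _ => trivial, ⟨aemeasurable_dirac, fun _ => aemeasurable_dirac, ?_, fun _ =>
    aemeasurable_const⟩, ?_, ?_, ?_, ?_, ?_, ?_⟩
  · change AEMeasurable c.act ((Measure.dirac θ₀).bind c.msg)
    rw [hbind]
    exact aemeasurable_dirac
  · intro k E₁ E₂ h₁ h₂
    change ∫⁻ θ in E₁, Measure.dirac (best θ) E₂ ∂Measure.dirac θ₀ =
      ∫⁻ θ, ∫⁻ m in E₂, Measure.dirac θ₀ E₁ ∂Measure.dirac (best θ) ∂Measure.dirac θ₀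
    rw [lintegral_dirac, setLIntegral_const, restrict_dirac' h₁, Measure.dirac_apply' θ₀ h₁]
    by_cases h : θ₀ ∈ E₁ <;> simp [h]
  · exact fun θ => integrable_dirac (by simp)
  · intro θ
    rw [hu]
    change 0 ≤ a θ (best θ)
    simp only [a]
    split_ifs <;> norm_num
  · intro θ m
    rw [hu]
    exact hbest θ m
  · intro k
    simp [revealingEnvironment]
  · intro k m y' _
    simp [revealingEnvironment]

/-- The allocation reveals which contractible actions principal `j` offers: these are the actions
`x` such that type `e x` obtains its favourite action. -/
theorem mem_range_iff_of_revealing [DecidableEq J] (hinj : Function.Injective e)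
    {𝒢 : SpaceProfile F} {c : Play Θ G}
    (hc : IsContinuationEquilibrium (revealingEnvironment X Y θ₀ j e he) 𝒢 G c) (x : X j) :
    x ∈ Set.range (G j).toFun ↔
      1 ≤ ∫ a, (revealingEnvironment X Y θ₀ j e he).agent a.1 a.2 (e x)
        ∂(c.allocation (e x)) := by
  rw [hc.measurable.integral_allocation _ (Environment.measurable_agent_state _ _)]
  constructor
  · rintro ⟨m₀, rfl⟩
    let m : MsgProfile G := Function.update (fun _ => Classical.arbitrary _) j m₀
    have hm : chosen G m j = (G j).toFun m₀ := by simp only [chosen, m, Function.update_self]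
    refine le_trans (le_of_eq ?_) (hc.agent_optimal _ m)
    simp [revealingEnvironment, hm]
  · intro h
    by_contra hx
    have h0 : ∀ m, (revealingEnvironment X Y θ₀ j e he).agent (chosen G m) (c.act m) (e x) = 0 :=
      fun m => if_neg fun h => hx ⟨m j, (hinj h).symm⟩
    simp only [h0, integral_zero] at h
    exact absurd h (by norm_num)

/-- A canonical contract space contains a contract with the range of any given contract. -/
theorem IsCanonicalForRobust.exists_range_eq [Countable J] [DecidableEq J]
    {𝒢 : SpaceProfile F} (h𝒢 : IsCanonicalForRobust Θ 𝒢) (hF : ∀ j x, (F j x).Nonempty)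
    (he : Measurable e) (hinj : Function.Injective e) (C : Contract (F j)) :
    ∃ C' ∈ 𝒢 j, Set.range C'.toFun = Set.range C.toFun := by
  choose base _ using h𝒢.1
  let E := revealingEnvironment X Y (e (C.toFun (Classical.arbitrary _))) j e he
  obtain ⟨c, hc⟩ := exists_isContinuationEquilibrium_revealing
    (θ₀ := e (C.toFun (Classical.arbitrary _))) (he := he) hF (Function.update base j C)
  have hz : c.allocation ∈ unrestrictedRobustAllocations F E := by
    refine ⟨_, c, isUnrestrictedRobustEquilibrium_iff.2 ⟨hc, fun k G' _ => ?_⟩, rfl⟩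
    obtain ⟨c', hc'⟩ := exists_isContinuationEquilibrium_revealing
      (θ₀ := e (C.toFun (Classical.arbitrary _))) (he := he) hF
        (Function.update (Function.update base j C) k G')
    refine ⟨c', hc', ?_⟩
    rw [revealingEnvironment_value, revealingEnvironment_value]
  rw [← h𝒢.2 E] at hz
  obtain ⟨G', c', hc', halloc⟩ := hz
  refine ⟨G' j, hc'.1.mem j, Set.ext fun x => ?_⟩
  rw [mem_range_iff_of_revealing hinj hc'.1 x, halloc,
    ← mem_range_iff_of_revealing hinj hc x, Function.update_self]

theorem spaceCard_menuSpace_le [∀ j, StandardBorelSpace (X j)] [∀ j, StandardBorelSpace (Y j)]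
    {𝒢 : SpaceProfile F}
    (h : ∀ j (C : Contract (F j)), ∃ C' ∈ 𝒢 j, Set.range C'.toFun = Set.range C.toFun) :
    spaceCard (menuSpace F) ≤ spaceCard 𝒢 := by
  choose r hr hrange using h
  have hinj : ∀ j, Function.Injective fun C : menuSpace F j => (⟨r j C, hr j C⟩ : 𝒢 j) := by
    rintro j ⟨_, L, hL, rfl⟩ ⟨_, L', hL', rfl⟩ h
    have h' := congrArg (fun C : 𝒢 j => Set.range C.1.toFun) h
    simp only [hrange] at h'
    have hLL : L = L' :=
      (range_fst_feasiblePairs hL).symm.trans (h'.trans (range_fst_feasiblePairs hL'))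
    exact Subtype.ext (menuContract_congr hLL hL hL')
  exact Cardinal.mk_le_of_injective (Function.Injective.piMap hinj)

end Minimal

end Contracting

theorem mainTheorem4
    {Θ : Type u} [MeasurableSpace Θ] [StandardBorelSpace Θ]
    {J : Type u} [Fintype J] [DecidableEq J]
    {X Y : J → Type u}
    [∀ j, MeasurableSpace (X j)] [∀ j, StandardBorelSpace (X j)]
    [∀ j, MeasurableSpace (Y j)] [∀ j, StandardBorelSpace (Y j)]
    (F : ∀ j, X j → Set (Y j))
    (hF_nonempty : ∀ j x, (F j x).Nonempty)
    (hF_admissible : ∀ j, ∃ x, MeasurableSet (F j x))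
    (h_nontrivial : ∀ j, {a : X j × Y j | a.2 ∈ F j a.1}.Nontrivial)
    (hJ : 2 ≤ Fintype.card J)
    (hΘ : Cardinal.mk (∀ j, X j) ≤ Cardinal.mk Θ) :
    Contracting.IsMinimalCanonicalForRobust Θ (Contracting.menuSpace F) := by
  have : Nontrivial J := Fintype.one_lt_card_iff_nontrivial.1 hJ
  have hX : ∀ j, Nonempty (X j) := fun j => ⟨(h_nontrivial j).nonempty.some.1⟩
  have hY : ∀ j, Nonempty (Y j) := fun j => ⟨(h_nontrivial j).nonempty.some.2⟩
  refine ⟨⟨fun j => ?_, fun E => ?_⟩, fun 𝒢' h𝒢' => ?_⟩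
  · obtain ⟨x, hx⟩ := hF_admissible j
    exact ⟨_, _, Contracting.singleton_mem_menus hx (hF_nonempty j x), rfl⟩
  · exact (Contracting.robustAllocations_menuSpace_subset E).antisymm
      (Contracting.unrestrictedRobustAllocations_subset E)
  · refine Contracting.spaceCard_menuSpace_le fun j C => ?_
    have hcard : Cardinal.mk (X j) ≤ Cardinal.mk (∀ j, X j) :=
      Cardinal.mk_le_of_injective
        (Function.update_injective (fun k => Classical.arbitrary (X k)) j)
    obtain ⟨e, he, hinj⟩ := Contracting.exists_measurable_injective (hcard.trans hΘ)
    exact h𝒢'.exists_range_eq hF_nonempty he hinj C
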